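/- Let $\theta>0$. There are constants $\gamma>0$ and $c>0$, depending only on $\theta$, such that the following holds for every sequence of nonnegative integers $m=m(n)$ with $m(n)/n\to\theta$ as $n\to\infty$ (for instance $m=\theta n$ up to rounding). Let $A$ be the random $(m+1)\times n$ matrix whose first $m$ rows have i.i.d. entries taking the values $0$ and $1$ with probability $\tfrac12$ each, and whose last row is all ones. Then for all sufficiently large $n$, with probability at least $1-e^{-cn}$, both of the following hold: (i) every nonzero vector $w\in\mathbb{R}^n$ with $Aw=0$ has at least $\gamma n$ positive and at least $\gamma n$ negative entries; (ii) for every $x_0\in\mathbb{R}^n$ with $x_0\ge 0$ (entrywise) and at most $\gamma n-1$ nonzero entries, $\{x\in\mathbb{R}^n : Ax=Ax_0,\ x\ge 0\}=\{x_0\}$. -/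

import Mathlib

open MeasureTheory ProbabilityTheory Filter Topology

/-- The `(m + 1) × n` measurement matrix whose first `m` rows are those of `B` and whose last row
is the all-ones row. -/
def appendOnesRow {m n : ℕ} (B : Matrix (Fin m) (Fin n) ℝ) : Matrix (Fin (m + 1)) (Fin n) ℝ :=
  Matrix.of fun i j => Fin.snoc (α := fun _ => ℝ) (fun k => B k j) 1 i

/-- `X` is a Bernoulli(1/2) random variable with values `0` and `1`. -/
structure IsBernoulliHalf {Ω : Type*} [MeasurableSpace Ω] (P : Measure Ω) (X : Ω → ℝ) : Prop where
  measurable : Measurable X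
  prob_zero : P {ω | X ω = 0} = 1 / 2
  prob_one : P {ω | X ω = 1} = 1 / 2

/-- The entries of the random matrix `B` are i.i.d. Bernoulli(1/2) variables. -/
structure IsIIDBernoulliMatrix {Ω : Type*} [MeasurableSpace Ω] (P : Measure Ω) {m n : ℕ}
    (B : Ω → Matrix (Fin m) (Fin n) ℝ) : Prop where
  bernoulli : ∀ i j, IsBernoulliHalf P (fun ω => B ω i j)
  indep : iIndepFun (fun (p : Fin m × Fin n) (ω : Ω) => B ω p.1 p.2) P

/-- The set of indices of positive entries. -/
noncomputable def posSupport {n : ℕ} (w : Fin n → ℝ) : Finset (Fin n) :=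
  Finset.univ.filter fun i => 0 < w i

/-- The set of indices of negative entries. -/
noncomputable def negSupport {n : ℕ} (w : Fin n → ℝ) : Finset (Fin n) :=
  Finset.univ.filter fun i => w i < 0

/-- Every nonzero vector in the null space of `A` has at least `s` positive and at least `s`
negative entries. -/
def NullVectorsBalanced {k n : ℕ} (A : Matrix (Fin k) (Fin n) ℝ) (s : ℝ) : Prop :=
  ∀ w : Fin n → ℝ, w ≠ 0 → A.mulVec w = 0 →
    s ≤ ((posSupport w).card : ℝ) ∧ s ≤ ((negSupport w).card : ℝ)

/-- Every nonnegative `x₀` with at most `s` nonzero entries is the only nonnegative solution `x`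
of `A x = A x₀`. -/
def UniqueNonnegRecovery {k n : ℕ} (A : Matrix (Fin k) (Fin n) ℝ) (s : ℝ) : Prop :=
  ∀ x₀ : Fin n → ℝ, 0 ≤ x₀ → ((Finset.univ.filter fun i => x₀ i ≠ 0).card : ℝ) ≤ s →
    {x : Fin n → ℝ | A.mulVec x = A.mulVec x₀ ∧ 0 ≤ x} = {x₀}

/-! Because of the all-ones row, a null vector `w` has zero sum, so it is also annihilated by the
sign matrix `R` with entries `2B - 1`. If `w` had few negative entries, zero sum and Cauchy–Schwarz
would make its `ℓ¹` norm small relative to its `ℓ²` norm (`sum_abs_sq_le_card_negSupport`). Scale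
`w` to `ℓ²` norm of order `√n` and round it towards zero to an integer vector `z`: then `z` has `ℓ¹`
norm at most `N ≈ ηn` but still `ℓ²` norm at least `T√n`, and `Rz = -R(w - z)` with `w - z` in the
unit cube.

Two events make this impossible. On the cube, `‖Re‖₁` stays below `a = K n^(3/2)`
(`card_exists_signForm_ge`). A fixed such `z` has `‖Rz‖₁ > a` outside an exponentially small event
(`card_sum_abs_signedSum_le`), and so few `z` exist (`card_intL1Ball_le`) that a union bound
survives. Applying this to `w` and `-w` gives (i), and (ii) follows because `x - x₀` can be negative
only on the support of `x₀`. -/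

/-! ### Random signed sums: moments and small-ball estimate -/

/-- The sign `1` or `-1` encoded by a Boolean. -/
def boolSign (b : Bool) : ℝ := if b then 1 else -1

@[simp] theorem boolSign_true : boolSign true = 1 := rfl

@[simp] theorem boolSign_false : boolSign false = -1 := rfl

theorem exists_boolSign_mul_eq_abs (a : ℝ) : ∃ b : Bool, boolSign b * a = |a| := by
  rcases le_total 0 a with h | h
  · exact ⟨true, by simp [abs_of_nonneg h]⟩
  · exact ⟨false, by simp [abs_of_nonpos h]⟩

/-- The signed sum `∑ j, ± x j`. -/
def signedSum {n : ℕ} (r : Fin n → Bool) (x : Fin n → ℝ) : ℝ := ∑ j, boolSign (r j) * x j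

theorem sum_fun_prod {n : ℕ} {X : Type*} [Fintype X] (F : Fin n → X → ℝ) :
    ∑ r : Fin n → X, ∏ j, F j (r j) = ∏ j, ∑ b, F j b := by
  rw [Finset.prod_univ_sum, Fintype.piFinset_univ]

theorem sum_bool_fun_succ {n : ℕ} (F : (Fin (n + 1) → Bool) → ℝ) :
    ∑ r, F r = ∑ r : Fin n → Bool, (F (Fin.cons true r) + F (Fin.cons false r)) := by
  rw [← (Fin.consEquiv fun _ : Fin (n + 1) => Bool).sum_comp, Fintype.sum_prod_type,
    Fintype.sum_bool, ← Finset.sum_add_distrib]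
  rfl

theorem signedSum_cons {n : ℕ} (b : Bool) (r : Fin n → Bool) (x : Fin (n + 1) → ℝ) :
    signedSum (Fin.cons b r : Fin (n + 1) → Bool) x =
      boolSign b * x 0 + signedSum r (fun j => x j.succ) := by
  simp [signedSum, Fin.sum_univ_succ]

theorem sum_signedSum_sq {n : ℕ} (x : Fin n → ℝ) :
    ∑ r, signedSum r x ^ 2 = 2 ^ n * ∑ j, x j ^ 2 := by
  induction n with
  | zero => simp [signedSum]
  | succ n ih =>
    have h : ∀ r : Fin n → Bool, signedSum (Fin.cons true r : Fin (n + 1) → Bool) x ^ 2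
        + signedSum (Fin.cons false r : Fin (n + 1) → Bool) x ^ 2
        = 2 * signedSum r (fun j => x j.succ) ^ 2 + 2 * x 0 ^ 2 := fun r => by
      rw [signedSum_cons, signedSum_cons, boolSign_true, boolSign_false]; ring
    rw [sum_bool_fun_succ, Finset.sum_congr rfl fun r _ => h r, Finset.sum_add_distrib,
      ← Finset.mul_sum, ih, Fin.sum_univ_succ]
    simp
    ring

theorem sum_signedSum_pow_four_le {n : ℕ} (x : Fin n → ℝ) :
    ∑ r, signedSum r x ^ 4 ≤ 2 ^ n * (3 * (∑ j, x j ^ 2) ^ 2) := by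
  induction n with
  | zero => simp [signedSum]
  | succ n ih =>
    have h : ∀ r : Fin n → Bool, signedSum (Fin.cons true r : Fin (n + 1) → Bool) x ^ 4
        + signedSum (Fin.cons false r : Fin (n + 1) → Bool) x ^ 4
        = 2 * signedSum r (fun j => x j.succ) ^ 4
          + 12 * x 0 ^ 2 * signedSum r (fun j => x j.succ) ^ 2 + 2 * x 0 ^ 4 := fun r => by
      rw [signedSum_cons, signedSum_cons, boolSign_true, boolSign_false]; ring
    rw [sum_bool_fun_succ, Finset.sum_congr rfl fun r _ => h r, Finset.sum_add_distrib,
      Finset.sum_add_distrib, ← Finset.mul_sum, ← Finset.mul_sum, sum_signedSum_sq,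
      Fin.sum_univ_succ]
    have := ih fun j => x j.succ
    have h2 : (0 : ℝ) ≤ 2 ^ n * x 0 ^ 4 := by positivity
    simp only [Finset.sum_const, Finset.card_univ, Fintype.card_fun, Fintype.card_bool,
      Fintype.card_fin, nsmul_eq_mul, Nat.cast_pow, Nat.cast_ofNat]
    rw [pow_succ (2 : ℝ) n]
    linarith

/-- A polynomial majorant in even powers, so that second and fourth moments suffice to bound the
expectation. -/
theorem exp_neg_abs_half_le (y : ℝ) :
    Real.exp (-(|y| / 2)) ≤ 1 - 3 / 8 * y ^ 2 + 2 / 27 * y ^ 4 := by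
  have hy := abs_nonneg y
  rw [← sq_abs y, show y ^ 4 = |y| ^ 4 by rw [← abs_pow, abs_of_nonneg (by positivity)]]
  generalize |y| = u at hy ⊢
  have h1 := Real.quadratic_le_exp_of_nonneg (x := u / 2) (by positivity)
  have h2 : Real.exp (-(u / 2)) ≤ 1 - u / 2 + u ^ 2 / 8 := by
    rw [Real.exp_neg]
    refine inv_le_of_inv_le₀ (by nlinarith [sq_nonneg (u - 2)]) (le_trans ?_ h1)
    rw [inv_le_iff_one_le_mul₀ (by nlinarith [sq_nonneg (u - 2)])]
    nlinarith [pow_nonneg hy 4]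
  -- The difference of the two sides is `u (2u - 3)² (u + 3) / 27`, with tangency at `u = 3/2`.
  have h3 : u ^ 2 - 4 / 27 * u ^ 4 ≤ u := by
    have : 0 ≤ u * ((2 * u - 3) ^ 2 * (u + 3)) := by positivity
    nlinarith
  linarith

/-- With normalized second moment 1 and fourth moment at most 3, the majorant averages to at most `1
- 3/8 + 2/9 < 7/8`. -/
theorem sum_exp_neg_abs_signedSum_le {n : ℕ} (x : Fin n → ℝ) {s : ℝ} (hs : 0 < s)
    (hx : ∑ j, x j ^ 2 = s ^ 2) :
    ∑ r, Real.exp (-(|signedSum r x| / (2 * s))) ≤ 2 ^ n * (7 / 8) := by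
  have h : ∀ r, Real.exp (-(|signedSum r x| / (2 * s))) ≤
      1 - 3 / 8 / s ^ 2 * signedSum r x ^ 2 + 2 / 27 / s ^ 4 * signedSum r x ^ 4 := fun r => by
    have := exp_neg_abs_half_le (signedSum r x / s)
    rw [abs_div, abs_of_pos hs, div_div, mul_comm s 2] at this
    convert this using 2
    · ring
    · ring
  refine (Finset.sum_le_sum fun r _ => h r).trans ?_
  rw [Finset.sum_add_distrib, Finset.sum_sub_distrib, ← Finset.mul_sum, ← Finset.mul_sum,
    sum_signedSum_sq, hx]
  have h4 := sum_signedSum_pow_four_le x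
  rw [hx] at h4
  have h5 : 2 / 27 / s ^ 4 * ∑ r, signedSum r x ^ 4 ≤ 2 ^ n * (2 / 9) := by
    calc _ ≤ 2 / 27 / s ^ 4 * (2 ^ n * (3 * (s ^ 2) ^ 2)) := by gcongr
      _ = _ := by field_simp; ring
  have h6 : 3 / 8 / s ^ 2 * (2 ^ n * s ^ 2) = 2 ^ n * (3 / 8 : ℝ) := by field_simp
  simp only [Finset.sum_const, Finset.card_univ, Fintype.card_fun, Fintype.card_bool,
      Fintype.card_fin, nsmul_eq_mul, Nat.cast_pow, Nat.cast_ofNat]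
  have : (0 : ℝ) < 2 ^ n := by positivity
  linarith

theorem card_filter_mul_le_sum {ι : Type*} [Fintype ι] (p : ι → Prop) [DecidablePred p]
    (F : ι → ℝ) (hF : ∀ i, 0 ≤ F i) {a : ℝ} (h : ∀ i, p i → a ≤ F i) :
    ((Finset.univ.filter p).card : ℝ) * a ≤ ∑ i, F i := by
  rw [← nsmul_eq_mul]
  refine (Finset.card_nsmul_le_sum _ F a fun i hi => h i (Finset.mem_filter.1 hi).2).trans ?_
  exact Finset.sum_le_sum_of_subset_of_nonneg (Finset.filter_subset _ _) fun i _ _ => hF i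

-- Exponential Markov inequality; the rows are independent, so the factor `7/8` is gained once per
-- row.
open Classical in
theorem card_sum_abs_signedSum_le {m n : ℕ} (x : Fin n → ℝ) {s a : ℝ} (hs : 0 < s)
    (hx : ∑ j, x j ^ 2 = s ^ 2) :
    ((Finset.univ.filter fun R : Fin m → Fin n → Bool =>
      ∑ i, |signedSum (R i) x| ≤ a).card : ℝ) ≤
      2 ^ (m * n) * (Real.exp (a / (2 * s)) * (7 / 8) ^ m) := by
  have h := card_filter_mul_le_sum
    (fun R : Fin m → Fin n → Bool => ∑ i, |signedSum (R i) x| ≤ a)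
    (fun R => ∏ i, Real.exp (-(|signedSum (R i) x| / (2 * s))))
    (fun R => Finset.prod_nonneg fun i _ => (Real.exp_pos _).le)
    (a := Real.exp (-(a / (2 * s)))) (fun R hR => by
      rw [← Real.exp_sum, Finset.sum_neg_distrib, ← Finset.sum_div]
      gcongr)
  rw [sum_fun_prod fun (_ : Fin m) r => Real.exp (-(|signedSum r x| / (2 * s)))] at h
  have h2 : ∏ _i : Fin m, ∑ r, Real.exp (-(|signedSum r x| / (2 * s))) ≤
      ∏ _i : Fin m, (2 ^ n * (7 / 8) : ℝ) :=
    Finset.prod_le_prod (fun i _ => Finset.sum_nonneg fun r _ => (Real.exp_pos _).le)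
      fun i _ => sum_exp_neg_abs_signedSum_le x hs hx
  have h3 := h.trans h2
  rw [Real.exp_neg, ← div_eq_mul_inv, div_le_iff₀ (Real.exp_pos _)] at h3
  refine h3.trans_eq ?_
  rw [Finset.prod_const, Finset.card_univ, Fintype.card_fin, mul_pow, ← pow_mul, mul_comm n m]
  ring

/-! ### Upper bound on the unit cube -/

/-- The bilinear form of the sign matrix `R` at the sign vectors `f` and `g`. -/
def signForm {m n : ℕ} (R : Fin m → Fin n → Bool) (f : Fin m → Bool) (g : Fin n → Bool) : ℝ :=
  ∑ i, ∑ j, boolSign (R i j) * (boolSign (f i) * boolSign (g j))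

/-- Fixed signs do not change the law of a random sign, so each entry contributes `cosh t ≤ exp (t²
/ 2)`. -/
theorem sum_exp_signForm_le {m n : ℕ} (f : Fin m → Bool) (g : Fin n → Bool) (t : ℝ) :
    ∑ R : Fin m → Fin n → Bool, Real.exp (t * signForm R f g) ≤
      2 ^ (m * n) * Real.exp (t ^ 2 / 2 * (m * n)) := by
  have h1 : ∀ R : Fin m → Fin n → Bool, Real.exp (t * signForm R f g) =
      ∏ i, ∏ j, Real.exp (t * (boolSign (R i j) * (boolSign (f i) * boolSign (g j)))) := by
    intro R
    simp only [signForm, Finset.mul_sum, Real.exp_sum]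
  have h2 : ∀ i j, ∑ b, Real.exp (t * (boolSign b * (boolSign (f i) * boolSign (g j)))) =
      2 * Real.cosh t := fun i j => by
    cases f i <;> cases g j <;> simp [Real.cosh_eq] <;> ring
  calc _ = ∑ R : Fin m → Fin n → Bool, ∏ i, ∏ j,
        Real.exp (t * (boolSign (R i j) * (boolSign (f i) * boolSign (g j)))) :=
        Finset.sum_congr rfl fun R _ => h1 R
    _ = ∏ i : Fin m, ∏ j : Fin n, (2 * Real.cosh t) := by
        rw [sum_fun_prod fun (i : Fin m) (r : Fin n → Bool) => ∏ j,
          Real.exp (t * (boolSign (r j) * (boolSign (f i) * boolSign (g j))))]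
        refine Finset.prod_congr rfl fun i _ => ?_
        rw [sum_fun_prod fun (j : Fin n) (b : Bool) =>
          Real.exp (t * (boolSign b * (boolSign (f i) * boolSign (g j))))]
        exact Finset.prod_congr rfl fun j _ => h2 i j
    _ = 2 ^ (m * n) * Real.cosh t ^ (m * n) := by
        simp only [Finset.prod_const, Finset.card_univ, Fintype.card_fin]
        rw [← pow_mul, mul_comm n m, mul_pow]
    _ ≤ 2 ^ (m * n) * Real.exp (t ^ 2 / 2) ^ (m * n) := by
        gcongr
        exact Real.cosh_le_exp_half_sq t
    _ = _ := by
        rw [← Real.exp_nat_mul]; push_cast; ring_nf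

open Classical in
theorem card_exists_signForm_ge {m n : ℕ} {t a : ℝ} (ht : 0 ≤ t) :
    ((Finset.univ.filter fun R : Fin m → Fin n → Bool => ∃ f g, a ≤ signForm R f g).card : ℝ) ≤
      2 ^ (m * n) * (2 ^ (m + n) * Real.exp (t ^ 2 / 2 * (m * n) - t * a)) := by
  have h := card_filter_mul_le_sum
    (fun R : Fin m → Fin n → Bool => ∃ f g, a ≤ signForm R f g)
    (fun R => ∑ f, ∑ g, Real.exp (t * signForm R f g))
    (fun R => Finset.sum_nonneg fun f _ => Finset.sum_nonneg fun g _ => (Real.exp_pos _).le)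
    (a := Real.exp (t * a)) (by
      rintro R ⟨f, g, hR⟩
      calc _ ≤ Real.exp (t * signForm R f g) := by gcongr
        _ ≤ ∑ g, Real.exp (t * signForm R f g) :=
          Finset.single_le_sum (f := fun g => Real.exp (t * signForm R f g))
            (fun g _ => (Real.exp_pos _).le) (Finset.mem_univ g)
        _ ≤ _ := Finset.single_le_sum (f := fun f => ∑ g, Real.exp (t * signForm R f g))
            (fun f _ => Finset.sum_nonneg fun g _ => (Real.exp_pos _).le) (Finset.mem_univ f))
  have h2 : ∑ R : Fin m → Fin n → Bool, ∑ f, ∑ g, Real.exp (t * signForm R f g) ≤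
      ∑ _f : Fin m → Bool, ∑ _g : Fin n → Bool,
        (2 ^ (m * n) * Real.exp (t ^ 2 / 2 * (m * n)) : ℝ) := by
    rw [Finset.sum_comm]
    refine Finset.sum_le_sum fun f _ => ?_
    rw [Finset.sum_comm]
    exact Finset.sum_le_sum fun g _ => sum_exp_signForm_le f g t
  have h3 := h.trans h2
  rw [← le_div_iff₀ (Real.exp_pos _)] at h3
  refine h3.trans_eq ?_
  simp only [Finset.sum_const, Finset.card_univ, Fintype.card_fun, Fintype.card_bool,
      Fintype.card_fin, nsmul_eq_mul, Nat.cast_pow, Nat.cast_ofNat]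
  rw [Real.exp_sub, pow_add]
  ring

/-! ### Counting integer points in an `ℓ¹` ball -/

theorem sum_pow_natAbs_Icc_le {q : ℝ} (hq : 0 ≤ q) (hq2 : q ≤ 1 / 2) (N : ℕ) :
    ∑ j ∈ Finset.Icc (-(N : ℤ)) N, q ^ j.natAbs ≤ 1 + 4 * q := by
  have hgeom : ∑ i ∈ Finset.range N, q ^ (i + 1) ≤ 2 * q := by
    have h := geom_sum_mul_neg q N
    have h0 : 0 ≤ q ^ N := by positivity
    have hS : 0 ≤ ∑ i ∈ Finset.range N, q ^ i := Finset.sum_nonneg fun i _ => by positivity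
    simp only [pow_succ, ← Finset.sum_mul]
    nlinarith
  have hsub : Finset.Icc (-(N : ℤ)) N ⊆ insert 0
      ((Finset.range N).image (fun i : ℕ => ((i : ℤ) + 1)) ∪
        (Finset.range N).image (fun i : ℕ => -((i : ℤ) + 1))) := by
    intro j hj
    simp only [Finset.mem_Icc] at hj
    simp only [Finset.mem_insert, Finset.mem_union, Finset.mem_image, Finset.mem_range]
    rcases lt_trichotomy j 0 with h | h | h
    · exact Or.inr (Or.inr ⟨(-j - 1).toNat, by omega, by omega⟩)
    · exact Or.inl h
    · exact Or.inr (Or.inl ⟨(j - 1).toNat, by omega, by omega⟩)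
  have hnn : ∀ j : ℤ, 0 ≤ q ^ j.natAbs := fun j => by positivity
  calc _ ≤ _ := Finset.sum_le_sum_of_subset_of_nonneg hsub fun j _ _ => hnn j
    _ ≤ q ^ (0 : ℤ).natAbs + ∑ j ∈ (Finset.range N).image (fun i : ℕ => ((i : ℤ) + 1)) ∪
        (Finset.range N).image (fun i : ℕ => -((i : ℤ) + 1)), q ^ j.natAbs := by
        rw [Finset.sum_insert (by
          simp only [Finset.mem_union, Finset.mem_image, Finset.mem_range, not_or, not_exists]
          exact ⟨fun i hi => by omega, fun i hi => by omega⟩)]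
    _ ≤ 1 + (∑ i ∈ Finset.range N, q ^ (i + 1) + ∑ i ∈ Finset.range N, q ^ (i + 1)) := by
        gcongr
        · simp
        · refine (le_add_of_nonneg_right (Finset.sum_nonneg fun j _ => hnn j)).trans
            (Finset.sum_union_inter (s₁ := (Finset.range N).image (fun i : ℕ => ((i : ℤ) + 1)))
              (s₂ := (Finset.range N).image (fun i : ℕ => -((i : ℤ) + 1)))).le |>.trans ?_
          rw [Finset.sum_image (fun a _ b _ h => by simpa using h),
            Finset.sum_image (fun a _ b _ h => by simpa using h)]
          refine add_le_add ?_ ?_ <;>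
            exact Finset.sum_le_sum fun i _ => le_of_eq (congrArg (q ^ ·) (by omega))
    _ ≤ _ := by linarith

/-- The integer vectors of `ℓ¹` norm at most `N`. -/
noncomputable def intL1Ball (n N : ℕ) : Finset (Fin n → ℤ) :=
  (Fintype.piFinset fun _ => Finset.Icc (-(N : ℤ)) N).filter fun z => ∑ j, (z j).natAbs ≤ N

theorem mem_intL1Ball {n N : ℕ} {z : Fin n → ℤ} :
    z ∈ intL1Ball n N ↔ ∑ j, (z j).natAbs ≤ N := by
  simp only [intL1Ball, Finset.mem_filter, Fintype.mem_piFinset, Finset.mem_Icc,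
    and_iff_right_iff_imp]
  intro h j
  have := (Finset.single_le_sum (f := fun j => (z j).natAbs) (fun _ _ => Nat.zero_le _)
    (Finset.mem_univ j)).trans h
  omega

/-- Generating function bound: weighting `z` by `q ^ ‖z‖₁` with `q = exp (-l) ≤ 1 / l` factorizes
over coordinates, each factor being at most `1 + 4q ≤ exp (4 / l)`. -/
theorem card_intL1Ball_le {n N : ℕ} {l : ℝ} (hl : 1 ≤ l) :
    ((intL1Ball n N).card : ℝ) ≤ Real.exp (l * N + 4 / l * n) := by
  have hl0 : 0 < l := by linarith
  set q := Real.exp (-l) with hq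
  have hq1 : q ≤ 1 / 2 := by
    rw [hq, Real.exp_neg, ← one_div]
    exact one_div_le_one_div_of_le (by norm_num) (by linarith [Real.add_one_le_exp l])
  have hq3 : q ≤ 1 / l := by
    rw [hq, Real.exp_neg, ← one_div]
    exact one_div_le_one_div_of_le hl0 (by linarith [Real.add_one_le_exp l])
  have hq0 : 0 < q := Real.exp_pos _
  have h1 : ((intL1Ball n N).card : ℝ) * q ^ N ≤
      ∑ z ∈ Fintype.piFinset fun _ : Fin n => Finset.Icc (-(N : ℤ)) N, ∏ j, q ^ (z j).natAbs := by
    rw [← nsmul_eq_mul]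
    refine (Finset.card_nsmul_le_sum _ (fun z => ∏ j, q ^ (z j).natAbs) _ fun z hz => ?_).trans
      (Finset.sum_le_sum_of_subset_of_nonneg (Finset.filter_subset _ _) fun z _ _ => ?_)
    · rw [Finset.prod_pow_eq_pow_sum]
      exact pow_le_pow_of_le_one hq0.le (by linarith) (mem_intL1Ball.1 hz)
    · exact Finset.prod_nonneg fun j _ => by positivity
  rw [← Finset.prod_univ_sum (fun _ : Fin n => Finset.Icc (-(N : ℤ)) N)
    fun _ k => q ^ k.natAbs] at h1
  have h2 : ∏ _j : Fin n, ∑ k ∈ Finset.Icc (-(N : ℤ)) N, q ^ k.natAbs ≤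
      ∏ _j : Fin n, Real.exp (4 / l) := by
    refine Finset.prod_le_prod (fun j _ => Finset.sum_nonneg fun k _ => by positivity) fun j _ => ?_
    refine (sum_pow_natAbs_Icc_le hq0.le hq1 N).trans ?_
    have := Real.add_one_le_exp (4 / l)
    have h4 : 4 / l = 4 * (1 / l) := by ring
    linarith
  have h3 := h1.trans h2
  rw [Finset.prod_const, Finset.card_univ, Fintype.card_fin, ← Real.exp_nat_mul,
    ← Real.exp_nat_mul, ← le_div_iff₀ (Real.exp_pos _), ← Real.exp_sub] at h3
  refine h3.trans_eq (congrArg _ ?_)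
  ring

/-! ### Deterministic rounding argument -/

/-- Rounding is towards zero, not to the nearest integer, so that the `ℓ¹` norm cannot grow. -/
theorem exists_int_round (w : ℝ) : ∃ z : ℤ, |(z : ℝ)| ≤ |w| ∧ |w - z| ≤ 1 := by
  rcases le_total 0 w with h | h
  · have h0 : (0 : ℝ) ≤ ⌊w⌋ := by exact_mod_cast Int.floor_nonneg.2 h
    refine ⟨⌊w⌋, ?_, ?_⟩
    · rw [abs_of_nonneg h, abs_of_nonneg h0]; exact Int.floor_le w
    · rw [abs_le]; constructor <;> linarith [Int.floor_le w, Int.lt_floor_add_one w]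
  · have h0 : (⌈w⌉ : ℝ) ≤ 0 := by
      have : ⌈w⌉ ≤ 0 := Int.ceil_le.2 (by simpa using h)
      exact_mod_cast this
    refine ⟨⌈w⌉, ?_, ?_⟩
    · rw [abs_of_nonpos h, abs_of_nonpos h0]; linarith [Int.le_ceil w]
    · rw [abs_le]; constructor <;> linarith [Int.le_ceil w, Int.ceil_lt_add_one w]

/-- Duality: `f` holds the signs of the row sums, and replacing `e` by the optimal sign vector `g`
can only increase the resulting linear form. -/
theorem sum_abs_signedSum_le_signForm {m n : ℕ} (R : Fin m → Fin n → Bool) (e : Fin n → ℝ)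
    (he : ∀ j, |e j| ≤ 1) :
    ∃ f g, ∑ i, |signedSum (R i) e| ≤ signForm R f g := by
  choose f hf using fun i => exists_boolSign_mul_eq_abs (signedSum (R i) e)
  choose g hg using fun j => exists_boolSign_mul_eq_abs (∑ i, boolSign (R i j) * boolSign (f i))
  refine ⟨f, g, ?_⟩
  have h1 : ∑ i, |signedSum (R i) e| = ∑ j, e j * ∑ i, boolSign (R i j) * boolSign (f i) := by
    rw [Finset.sum_congr rfl fun i _ => (hf i).symm]
    simp only [signedSum, Finset.mul_sum]
    rw [Finset.sum_comm]
    exact Finset.sum_congr rfl fun j _ => Finset.sum_congr rfl fun i _ => by ring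
  have h2 : signForm R f g = ∑ j, |∑ i, boolSign (R i j) * boolSign (f i)| := by
    rw [Finset.sum_congr rfl fun j _ => (hg j).symm]
    simp only [signForm, Finset.mul_sum]
    rw [Finset.sum_comm]
    exact Finset.sum_congr rfl fun j _ => Finset.sum_congr rfl fun i _ => by ring
  rw [h1, h2]
  refine Finset.sum_le_sum fun j _ => (le_abs_self _).trans ?_
  rw [abs_mul]
  exact mul_le_of_le_one_left (abs_nonneg _) (he j)

/-- If `∑ w = 0`, the `ℓ¹` norm of `w` is controlled by its negative entries. -/
theorem sum_abs_sq_le_card_negSupport {n : ℕ} (w : Fin n → ℝ) (hw : ∑ j, w j = 0) :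
    (∑ j, |w j|) ^ 2 ≤ 4 * ((negSupport w).card * ∑ j, w j ^ 2) := by
  have h1 : ∑ j, |w j| = 2 * ∑ j ∈ negSupport w, |w j| := by
    have : ∑ j, |w j| = ∑ j, (w j + 2 * if w j < 0 then |w j| else 0) := by
      refine Finset.sum_congr rfl fun j _ => ?_
      split_ifs with h
      · rw [abs_of_neg h]; ring
      · rw [abs_of_nonneg (not_lt.1 h)]; ring
    rw [this, Finset.sum_add_distrib, hw, ← Finset.mul_sum, ← Finset.sum_filter, zero_add]
    rfl
  have h2 : (∑ j ∈ negSupport w, |w j|) ^ 2 ≤ (negSupport w).card * ∑ j, w j ^ 2 := by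
    refine sq_sum_le_card_mul_sum_sq.trans ?_
    gcongr
    simp only [sq_abs]
    exact Finset.sum_le_sum_of_subset_of_nonneg (Finset.filter_subset _ _)
      fun j _ _ => sq_nonneg _
  rw [h1]
  linarith

theorem negSupport_smul {n : ℕ} (w : Fin n → ℝ) {a : ℝ} (ha : 0 < a) :
    negSupport (a • w) = negSupport w := by
  ext j
  simp [negSupport, mul_neg_iff, ha, ha.not_gt]

theorem signedSum_sub {n : ℕ} (r : Fin n → Bool) (x y : Fin n → ℝ) :
    signedSum r (x - y) = signedSum r x - signedSum r y := by
  simp [signedSum, mul_sub, Finset.sum_sub_distrib]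

theorem signedSum_smul {n : ℕ} (r : Fin n → Bool) (a : ℝ) (x : Fin n → ℝ) :
    signedSum r (a • x) = a * signedSum r x := by
  simp only [signedSum, Pi.smul_apply, smul_eq_mul, Finset.mul_sum]
  exact Finset.sum_congr rfl fun j _ => by ring

/-- The signed sums of `R` are uniformly small at the vectors of the unit cube, whereas their `ℓ¹`
norm is large at the integer vectors of small `ℓ¹` norm and large `ℓ²` norm. -/
def SeparatesLatticePoints {m n : ℕ} (R : Fin m → Fin n → Bool) (N : ℕ) (a T : ℝ) : Prop :=
  (∀ f g, signForm R f g < a) ∧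
    ∀ z ∈ intL1Ball n N, T ^ 2 * n ≤ ∑ j, (z j : ℝ) ^ 2 →
      a < ∑ i, |signedSum (R i) fun j => (z j : ℝ)|

theorem card_negSupport_of_sum_sq_eq {m n N : ℕ} {a T : ℝ} (R : Fin m → Fin n → Bool)
    (hR : SeparatesLatticePoints R N a T)
    (w : Fin n → ℝ) (hw : ∑ j, w j = 0) (hker : ∀ i, signedSum (R i) w = 0)
    (hnorm : ∑ j, w j ^ 2 = 2 * (T ^ 2 + 1) * n) :
    (N : ℝ) ^ 2 < 4 * ((negSupport w).card * (2 * (T ^ 2 + 1) * n)) := by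
  by_contra! hN
  choose z hz1 hz2 using fun j => exists_int_round (w j)
  have hmem : z ∈ intL1Ball n N := by
    rw [mem_intL1Ball]
    have h1 : ∑ j, |w j| ≤ N := by
      refine (sq_le_sq₀ (Finset.sum_nonneg fun _ _ => abs_nonneg _) (Nat.cast_nonneg N)).1 ((sum_abs_sq_le_card_negSupport w hw).trans ?_)
      rwa [hnorm]
    have h2 : ((∑ j, (z j).natAbs : ℕ) : ℝ) ≤ N := by
      push_cast
      refine (Finset.sum_le_sum fun j _ => ?_).trans h1
      rw [Nat.cast_natAbs]
      simpa using hz1 j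
    exact_mod_cast h2
  have hsq : T ^ 2 * n ≤ ∑ j, (z j : ℝ) ^ 2 := by
    have h : ∑ j, w j ^ 2 ≤ ∑ j, (2 * (z j : ℝ) ^ 2 + 2) := by
      refine Finset.sum_le_sum fun j _ => ?_
      -- From `|w - z| ≤ 1`, `w² ≤ 2z² + 2`; this is why the normalization is `2(T² + 1)n`.
      have := (sq_le_one_iff_abs_le_one _).2 (hz2 j)
      nlinarith [sq_nonneg (w j - 2 * z j)]
    rw [hnorm, Finset.sum_add_distrib, ← Finset.mul_sum] at h
    simp at h
    linarith
  obtain ⟨f, g, hfg⟩ := sum_abs_signedSum_le_signForm R (w - fun j => (z j : ℝ)) hz2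
  simp only [signedSum_sub, hker, zero_sub, abs_neg] at hfg
  linarith [hR.2 z hmem hsq, hR.1 f g]

theorem card_negSupport_of_ne_zero {m n N : ℕ} {a T : ℝ} (R : Fin m → Fin n → Bool)
    (hR : SeparatesLatticePoints R N a T)
    (w : Fin n → ℝ) (hw0 : w ≠ 0) (hw : ∑ j, w j = 0) (hker : ∀ i, signedSum (R i) w = 0) :
    (N : ℝ) ^ 2 < 4 * ((negSupport w).card * (2 * (T ^ 2 + 1) * n)) := by
  have hpos : 0 < ∑ j, w j ^ 2 := by
    obtain ⟨j, hj⟩ := Function.ne_iff.1 hw0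
    exact Finset.sum_pos' (fun j _ => sq_nonneg _) ⟨j, Finset.mem_univ j, by
      have : w j ≠ 0 := hj
      positivity⟩
  have hn : 0 < n := by
    rcases Nat.eq_zero_or_pos n with rfl | h
    · simp at hpos
    · exact h
  have hc : 0 < 2 * (T ^ 2 + 1) * (n : ℝ) := by positivity
  set b := Real.sqrt (2 * (T ^ 2 + 1) * n / ∑ j, w j ^ 2) with hb
  have hb0 : 0 < b := Real.sqrt_pos.2 (by positivity)
  have hb2 : b ^ 2 = 2 * (T ^ 2 + 1) * n / ∑ j, w j ^ 2 := Real.sq_sqrt (by positivity)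
  rw [← negSupport_smul w hb0]
  refine card_negSupport_of_sum_sq_eq R hR (b • w) ?_ (fun i => ?_) ?_
  · simp [← Finset.mul_sum, hw]
  · rw [signedSum_smul, hker, mul_zero]
  · simp only [Pi.smul_apply, smul_eq_mul, mul_pow, ← Finset.mul_sum, hb2]
    field_simp

/-! ### From sign matrices to null vectors and recovery -/

/-- The `0`-`1` matrix encoded by a Boolean matrix. -/
def boolMatrix {m n : ℕ} (R : Fin m → Fin n → Bool) : Matrix (Fin m) (Fin n) ℝ :=
  Matrix.of fun i j => if R i j then 1 else 0

theorem appendOnesRow_mulVec_eq_zero {m n : ℕ} {B : Matrix (Fin m) (Fin n) ℝ} {w : Fin n → ℝ}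
    (h : (appendOnesRow B).mulVec w = 0) : B.mulVec w = 0 ∧ ∑ j, w j = 0 := by
  constructor
  · ext i
    simpa [appendOnesRow, Matrix.mulVec, dotProduct] using congrFun h i.castSucc
  · simpa [appendOnesRow, Matrix.mulVec, dotProduct] using congrFun h (Fin.last m)

theorem signedSum_eq_zero_of_mulVec {m n : ℕ} {R : Fin m → Fin n → Bool} {w : Fin n → ℝ}
    (h : (boolMatrix R).mulVec w = 0) (hw : ∑ j, w j = 0) (i : Fin m) :
    signedSum (R i) w = 0 := by
  have h1 : ∑ j, (if R i j then (1 : ℝ) else 0) * w j = 0 := by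
    simpa [boolMatrix, Matrix.mulVec, dotProduct] using congrFun h i
  have h2 : signedSum (R i) w =
      2 * (∑ j, (if R i j then (1 : ℝ) else 0) * w j) - ∑ j, w j := by
    rw [signedSum, Finset.mul_sum, ← Finset.sum_sub_distrib]
    refine Finset.sum_congr rfl fun j _ => ?_
    cases R i j <;> simp
    ring
  rw [h2, h1, hw]
  ring

theorem posSupport_eq_negSupport_neg {n : ℕ} (w : Fin n → ℝ) :
    posSupport w = negSupport (-w) := by
  ext j; simp [posSupport, negSupport]

theorem nullVectorsBalanced_boolMatrix {m n N : ℕ} {a T s : ℝ} (R : Fin m → Fin n → Bool)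
    (hn : 0 < n) (hs : 4 * (s * (2 * (T ^ 2 + 1) * n)) ≤ (N : ℝ) ^ 2)
    (hR : SeparatesLatticePoints R N a T) :
    NullVectorsBalanced (appendOnesRow (boolMatrix R)) s := by
  have key : ∀ w : Fin n → ℝ, w ≠ 0 → (appendOnesRow (boolMatrix R)).mulVec w = 0 →
      s ≤ (negSupport w).card := by
    intro w hw0 hw
    obtain ⟨h1, h2⟩ := appendOnesRow_mulVec_eq_zero hw
    have h := hs.trans_lt (card_negSupport_of_ne_zero R hR w hw0 h2
      (signedSum_eq_zero_of_mulVec h1 h2))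
    have hc : 0 < 2 * (T ^ 2 + 1) * (n : ℝ) := by positivity
    have h3 := lt_of_mul_lt_mul_left h (by norm_num)
    exact (lt_of_mul_lt_mul_right h3 hc.le).le
  intro w hw0 hw
  refine ⟨?_, key w hw0 hw⟩
  rw [posSupport_eq_negSupport_neg]
  exact key _ (neg_ne_zero.2 hw0) (by rw [Matrix.mulVec_neg, hw, neg_zero])

theorem NullVectorsBalanced.uniqueNonnegRecovery {k n : ℕ} {A : Matrix (Fin k) (Fin n) ℝ} {s t : ℝ}
    (h : NullVectorsBalanced A s) (hts : t < s) : UniqueNonnegRecovery A t := by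
  intro x₀ hx₀ hcard
  refine Set.eq_singleton_iff_unique_mem.2 ⟨⟨rfl, hx₀⟩, fun x ⟨hAx, hx⟩ => ?_⟩
  by_contra hne
  have hneg := (h (x - x₀) (sub_ne_zero.2 hne) (by rw [Matrix.mulVec_sub, hAx, sub_self])).2
  have hsub : negSupport (x - x₀) ⊆ Finset.univ.filter fun i => x₀ i ≠ 0 := by
    intro i hi
    simp only [negSupport, Finset.mem_filter, Finset.mem_univ, true_and, Pi.sub_apply] at hi ⊢
    have : 0 ≤ x i := hx i
    intro h0
    linarith
  have : ((negSupport (x - x₀)).card : ℝ) ≤ _ := Nat.cast_le.2 (Finset.card_le_card hsub)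
  linarith

/-! ### Union bound and choice of constants -/

open Classical in
theorem card_bad_sign_matrices_le {m n N : ℕ} {a T t l : ℝ} (hn : 0 < n) (ha : 0 ≤ a) (hT : 0 < T)
    (ht : 0 ≤ t) (hl : 1 ≤ l) :
    ((Finset.univ.filter fun R : Fin m → Fin n → Bool =>
      ¬ SeparatesLatticePoints R N a T).card : ℝ) ≤
      2 ^ (m * n) * (2 ^ (m + n) * Real.exp (t ^ 2 / 2 * (m * n) - t * a) +
        Real.exp (l * N + 4 / l * n) * (Real.exp (a / (2 * (T * √n))) * (7 / 8) ^ m)) := by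
  set net := (intL1Ball n N).filter fun z => T ^ 2 * n ≤ ∑ j, (z j : ℝ) ^ 2 with hnet
  have hsub : (Finset.univ.filter fun R : Fin m → Fin n → Bool =>
      ¬ SeparatesLatticePoints R N a T) ⊆
      (Finset.univ.filter fun R : Fin m → Fin n → Bool => ∃ f g, a ≤ signForm R f g) ∪
      net.biUnion fun z => Finset.univ.filter fun R : Fin m → Fin n → Bool =>
        ∑ i, |signedSum (R i) fun j => (z j : ℝ)| ≤ a := by
    intro R hR
    simp only [Finset.mem_filter, Finset.mem_univ, true_and, Finset.mem_union,
      Finset.mem_biUnion, hnet] at hR ⊢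
    by_contra! hcon
    exact hR ⟨hcon.1, fun z hz hz2 => hcon.2 z ⟨hz, hz2⟩⟩
  have hz : ∀ z ∈ net, ((Finset.univ.filter fun R : Fin m → Fin n → Bool =>
        ∑ i, |signedSum (R i) fun j => (z j : ℝ)| ≤ a).card : ℝ) ≤
      2 ^ (m * n) * (Real.exp (a / (2 * (T * √n))) * (7 / 8) ^ m) := by
    intro z hz
    have hz2 := (Finset.mem_filter.1 hz).2
    have hTn : 0 < T * √n := by positivity
    have hs : T * √n ≤ √(∑ j, (z j : ℝ) ^ 2) := by
      refine Real.le_sqrt_of_sq_le ?_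
      rwa [mul_pow, Real.sq_sqrt (Nat.cast_nonneg n)]
    refine (card_sum_abs_signedSum_le (fun j => (z j : ℝ)) (hTn.trans_le hs)
      (Real.sq_sqrt (Finset.sum_nonneg fun j _ => sq_nonneg _)).symm).trans ?_
    gcongr
  have h1 : ((Finset.univ.filter fun R : Fin m → Fin n → Bool =>
      ¬ SeparatesLatticePoints R N a T).card : ℝ) ≤ _ :=
    Nat.cast_le.2 ((Finset.card_le_card hsub).trans ((Finset.card_union_le _ _).trans
      (Nat.add_le_add_left Finset.card_biUnion_le _)))
  refine h1.trans ?_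
  push_cast
  rw [mul_add]
  refine add_le_add (card_exists_signForm_ge ht) ((Finset.sum_le_sum hz).trans ?_)
  rw [Finset.sum_const, nsmul_eq_mul, mul_left_comm]
  gcongr
  exact (Nat.cast_le.2 (Finset.card_le_card (Finset.filter_subset _ _))).trans
    (card_intL1Ball_le hl)

theorem two_pow_le_exp (k : ℕ) : (2 : ℝ) ^ k ≤ Real.exp k := by
  rw [← mul_one (k : ℝ), Real.exp_nat_mul]
  gcongr
  linarith [Real.add_one_le_exp 1]

theorem seven_eighths_pow_le_exp (k : ℕ) : (7 / 8 : ℝ) ^ k ≤ Real.exp (-(k / 8)) := by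
  rw [show -((k : ℝ) / 8) = k * (-(1 / 8)) by ring, Real.exp_nat_mul]
  gcongr
  linarith [Real.add_one_le_exp (-(1 / 8))]

/-- `K` makes the first exponent `m + n + m/2 - Kn` at most `-n`. In the second, `m/8 ≥ 4 · θn/64`,
while `T`, `η` and `l` hold the three competing terms to `θn/64` each. -/
theorem failure_bound_le {θ K T l η : ℝ} (hθ : 0 < θ) (hK : K = 3 / 2 * (θ + 1) + 2)
    (hT : T = 32 * K / θ) (hl : l = 1 + 256 / θ) (hη : η = θ / (64 * l)) {m n N : ℕ} (hn : 0 < n)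
    (hm1 : θ / 2 * n ≤ m) (hm2 : (m : ℝ) ≤ (θ + 1) * n) (hN : (N : ℝ) ≤ η * n) :
    2 ^ (m + n) * Real.exp ((1 / √n) ^ 2 / 2 * (m * n) - 1 / √n * (K * n * √n)) +
        Real.exp (l * N + 4 / l * n) * (Real.exp (K * n * √n / (2 * (T * √n))) * (7 / 8) ^ m) ≤
      Real.exp (-n) + Real.exp (-(θ / 64 * n)) := by
  have hn0 : (0 : ℝ) < n := Nat.cast_pos.2 hn
  have hsn : 0 < √(n : ℝ) := Real.sqrt_pos.2 hn0
  have hK0 : 0 < K := by rw [hK]; positivity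
  have hl0 : 0 < l := by rw [hl]; positivity
  apply add_le_add
  · calc _ ≤ Real.exp (m + n : ℕ) *
          Real.exp ((1 / √n) ^ 2 / 2 * (m * n) - 1 / √n * (K * n * √n)) := by
          gcongr; exact two_pow_le_exp _
      _ ≤ _ := by
          rw [← Real.exp_add]
          apply Real.exp_le_exp.2
          rw [div_pow, Real.sq_sqrt hn0.le,
            show 1 ^ 2 / (n : ℝ) / 2 * (m * n) - 1 / √n * (K * n * √n) = m / 2 - K * n by
              field_simp, hK]
          push_cast
          nlinarith
  · calc _ ≤ Real.exp (l * N + 4 / l * n) *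
          (Real.exp (K * n * √n / (2 * (T * √n))) * Real.exp (-(m / 8))) := by
          gcongr; exact seven_eighths_pow_le_exp _
      _ ≤ _ := by
          rw [← Real.exp_add, ← Real.exp_add]
          apply Real.exp_le_exp.2
          have e1 : K * n * √n / (2 * (T * √n)) = θ / 64 * n := by
            rw [hT]; field_simp; norm_num
          have e2 : l * N ≤ θ / 64 * n := by
            calc l * N ≤ l * (η * n) := by gcongr
              _ = _ := by rw [hη]; field_simp
          have e3 : 4 / l ≤ θ / 64 := by
            rw [div_le_iff₀ hl0, hl]
            have : θ / 64 * (1 + 256 / θ) = θ / 64 + 4 := by field_simp; ring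
            linarith
          have e4 : 4 / l * n ≤ θ / 64 * n := by gcongr
          rw [e1]
          linarith

/-! ### Transfer to the random matrix and conclusion -/

theorem IsIIDBernoulliMatrix.measure_eq_boolMatrix {Ω : Type*} [MeasurableSpace Ω] {P : Measure Ω}
    {m n : ℕ} {B : Ω → Matrix (Fin m) (Fin n) ℝ} (hB : IsIIDBernoulliMatrix P B)
    (R : Fin m → Fin n → Bool) :
    MeasurableSet {ω | B ω = boolMatrix R} ∧
      P {ω | B ω = boolMatrix R} = (1 / 2) ^ (m * n) := by
  have hset : {ω | B ω = boolMatrix R} =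
      ⋂ p ∈ (Finset.univ : Finset (Fin m × Fin n)),
        (fun ω => B ω p.1 p.2) ⁻¹' {boolMatrix R p.1 p.2} := by
    ext ω
    simp [← Matrix.ext_iff]
  constructor
  · rw [hset]
    exact Finset.measurableSet_biInter _ fun p _ =>
      (hB.bernoulli p.1 p.2).measurable (measurableSet_singleton _)
  · rw [hset, hB.indep.measure_inter_preimage_eq_mul _ fun p _ => measurableSet_singleton _]
    have h : ∀ p : Fin m × Fin n,
        P ((fun ω => B ω p.1 p.2) ⁻¹' {boolMatrix R p.1 p.2}) = 1 / 2 := by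
      intro p
      rcases h : R p.1 p.2 with _ | _
      · have h0 : boolMatrix R p.1 p.2 = 0 := by simp [boolMatrix, h]
        rw [h0]; exact (hB.bernoulli p.1 p.2).prob_zero
      · have h0 : boolMatrix R p.1 p.2 = 1 := by simp [boolMatrix, h]
        rw [h0]; exact (hB.bernoulli p.1 p.2).prob_one
    rw [Finset.prod_congr rfl fun p _ => h p]
    simp

theorem boolMatrix_injective {m n : ℕ} :
    Function.Injective (boolMatrix : (Fin m → Fin n → Bool) → _) := by
  intro R S h
  ext i j
  have := congrFun (congrFun h i) j
  cases hR : R i j <;> cases hS : S i j <;> simp [boolMatrix, hR, hS] at this ⊢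

-- The law of `B` is uniform on Boolean matrices, so counting bounds become probabilities. Only
-- monotonicity is applied to the event `Q`, so its measurability is not needed.
open Classical in
theorem IsIIDBernoulliMatrix.one_sub_le_measureReal {Ω : Type*} [MeasurableSpace Ω] {P : Measure Ω}
    [IsProbabilityMeasure P] {m n : ℕ} {B : Ω → Matrix (Fin m) (Fin n) ℝ}
    (hB : IsIIDBernoulliMatrix P B) {p : (Fin m → Fin n → Bool) → Prop}
    {Q : Matrix (Fin m) (Fin n) ℝ → Prop} (hpQ : ∀ R, p R → Q (boolMatrix R)) {ε : ℝ}
    (hε : ((Finset.univ.filter fun R => ¬ p R).card : ℝ) ≤ 2 ^ (m * n) * ε) :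
    1 - ε ≤ P.real {ω | Q (B ω)} := by
  have h1 : P.real (⋃ R ∈ Finset.univ.filter p, {ω | B ω = boolMatrix R}) =
      (Finset.univ.filter p).card * (1 / 2) ^ (m * n) := by
    rw [measureReal_biUnion_finset]
    · simp [measureReal_def, (hB.measure_eq_boolMatrix _).2]
    · intro R _ S _ hRS
      refine Set.disjoint_left.2 fun ω h1 h2 => hRS (boolMatrix_injective ?_)
      exact h1.symm.trans h2
    · exact fun R _ => (hB.measure_eq_boolMatrix R).1
  have h2 : P.real (⋃ R ∈ Finset.univ.filter p, {ω | B ω = boolMatrix R}) ≤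
      P.real {ω | Q (B ω)} := by
    refine measureReal_mono fun ω hω => ?_
    simp only [Set.mem_iUnion, Finset.mem_filter, Finset.mem_univ, true_and, Set.mem_ofPred_eq,
      exists_prop] at hω ⊢
    obtain ⟨R, hR, h⟩ := hω
    rw [h]
    exact hpQ R hR
  have h3 : ((Finset.univ.filter p).card : ℝ) + (Finset.univ.filter fun R => ¬ p R).card =
      2 ^ (m * n) := by
    rw [← Nat.cast_add, Finset.card_filter_add_card_filter_not]
    simp [← pow_mul, mul_comm]
  refine le_trans ?_ (h1.symm.le.trans h2)
  rw [one_div, inv_pow, ← div_eq_mul_inv, le_div_iff₀ (by positivity)]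
  linarith

theorem theorem1 :
    ∀ θ : ℝ, 0 < θ → ∃ γ : ℝ, 0 < γ ∧ ∃ c : ℝ, 0 < c ∧
      ∀ m : ℕ → ℕ, Tendsto (fun n : ℕ => (m n : ℝ) / (n : ℝ)) atTop (𝓝 θ) →
        ∀ᶠ n : ℕ in atTop,
          ∀ (Ω : Type*) [MeasurableSpace Ω] (P : Measure Ω) [IsProbabilityMeasure P]
            (B : Ω → Matrix (Fin (m n)) (Fin n) ℝ), IsIIDBernoulliMatrix P B →
            1 - Real.exp (-c * (n : ℝ)) ≤
              P.real {ω | NullVectorsBalanced (appendOnesRow (B ω)) (γ * (n : ℝ)) ∧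
                UniqueNonnegRecovery (appendOnesRow (B ω)) (γ * (n : ℝ) - 1)} := by
  intro θ hθ
  obtain ⟨K, hK⟩ : ∃ K, K = 3 / 2 * (θ + 1) + 2 := ⟨_, rfl⟩
  obtain ⟨T, hT⟩ : ∃ T, T = 32 * K / θ := ⟨_, rfl⟩
  obtain ⟨l, hl⟩ : ∃ l, l = 1 + 256 / θ := ⟨_, rfl⟩
  obtain ⟨η, hη⟩ : ∃ η, η = θ / (64 * l) := ⟨_, rfl⟩
  have hK0 : 0 < K := by rw [hK]; positivity
  have hT0 : 0 < T := by rw [hT]; positivity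
  have hl1 : 1 ≤ l := by rw [hl]; linarith [show 0 < 256 / θ by positivity]
  have hη0 : 0 < η := by rw [hη]; positivity
  -- Half the available rate: the spare factor `exp (-cn) ≤ 1/2` absorbs the sum of two failure
  -- terms.
  obtain ⟨c, hc⟩ : ∃ c, c = min 1 (θ / 64) / 2 := ⟨_, rfl⟩
  have hc0 : 0 < c := by rw [hc]; positivity
  have hc1 : 2 * c ≤ 1 := by rw [hc]; linarith [min_le_left 1 (θ / 64)]
  have hc2 : 2 * c ≤ θ / 64 := by rw [hc]; linarith [min_le_right 1 (θ / 64)]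
  -- This `γ` makes `4 · γn · 2(T² + 1)n` equal to `(ηn/2)²`, which is at most `N²` for `N = ⌊ηn⌋₊`
  -- once `ηn ≥ 2`.
  refine ⟨η ^ 2 / (32 * (T ^ 2 + 1)), by positivity, c, hc0, fun m hm => ?_⟩
  have hcast := tendsto_natCast_atTop_atTop (R := ℝ)
  filter_upwards [hm.eventually_const_lt (show θ / 2 < θ by linarith),
    hm.eventually_lt_const (show θ < θ + 1 by linarith), eventually_gt_atTop 0,
    hcast.eventually_ge_atTop (2 / η), hcast.eventually_ge_atTop (1 / c)]
    with n hm1 hm2 hn hnη hnc Ω _ P _ B hB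
  have hn0 : (0 : ℝ) < n := Nat.cast_pos.2 hn
  rw [lt_div_iff₀ hn0] at hm1
  rw [div_lt_iff₀ hn0] at hm2
  rw [div_le_iff₀ hη0] at hnη
  rw [div_le_iff₀ hc0] at hnc
  have hN1 : ((⌊η * n⌋₊ : ℕ) : ℝ) ≤ η * n := Nat.floor_le (by positivity)
  have hN2 : η * n / 2 ≤ (⌊η * n⌋₊ : ℕ) := by linarith [Nat.lt_floor_add_one (η * n)]
  refine hB.one_sub_le_measureReal (p := fun R => SeparatesLatticePoints R ⌊η * n⌋₊ (K * n * √n) T)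
    (Q := fun B => NullVectorsBalanced (appendOnesRow B) (η ^ 2 / (32 * (T ^ 2 + 1)) * (n : ℝ)) ∧
      UniqueNonnegRecovery (appendOnesRow B) (η ^ 2 / (32 * (T ^ 2 + 1)) * (n : ℝ) - 1))
    (fun R hR => ?_) ?_
  · have hbal := nullVectorsBalanced_boolMatrix (s := η ^ 2 / (32 * (T ^ 2 + 1)) * n) R hn (by
      calc _ = (η * n / 2) ^ 2 := by field_simp; ring
        _ ≤ _ := by gcongr) hR
    exact ⟨hbal, hbal.uniqueNonnegRecovery (by linarith)⟩
  · refine (card_bad_sign_matrices_le (t := 1 / √n) (l := l) hn (by positivity) hT0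
      (by positivity) hl1).trans ?_
    gcongr
    refine (failure_bound_le hθ hK hT hl hη hn hm1.le hm2.le hN1).trans ?_
    have h1 : Real.exp (-n) ≤ Real.exp (-c * n) * Real.exp (-c * n) := by
      rw [← Real.exp_add]
      apply Real.exp_le_exp.2
      nlinarith
    have h2 : Real.exp (-(θ / 64 * n)) ≤ Real.exp (-c * n) * Real.exp (-c * n) := by
      rw [← Real.exp_add]
      apply Real.exp_le_exp.2
      nlinarith
    have h3 : Real.exp (-c * n) ≤ 1 / 2 := by
      rw [neg_mul, Real.exp_neg, ← one_div]
      exact one_div_le_one_div_of_le (by norm_num) (by linarith [Real.add_one_le_exp (c * n)])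
    nlinarith [Real.exp_pos (-c * n)]
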